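/- Let $q$ be a prime power. For a homogeneous polynomial $F\in\mathbb{F}_{q^2}[x_0,x_1,x_2,x_3]$ let $V(F)$ be its zero set in $\mathbb{P}^3$ over an algebraic closure of $\mathbb{F}_{q^2}$, and for a subset $Z\subseteq\mathbb{P}^3$ let $Z(\mathbb{F}_{q^2})$ be the set of its $\mathbb{F}_{q^2}$-rational points. Let $H=(h_{ij})$ be a $4\times 4$ Hermitian matrix over $\mathbb{F}_{q^2}$ (that is, $H\neq 0$ and $h_{ij}=h_{ji}^q$ for all $i,j$) of rank $3$, and let $P\mathcal{U}_2=V\big(\sum_{i,j}h_{ij}x_ix_j^q\big)$ be the corresponding degenerate Hermitian surface. It is a cone over a non-degenerate Hermitian curve whose vertex $P$ is the unique point $x$ with $x^TH=0$; this point is $\mathbb{F}_{q^2}$-rational. Let $F\in\mathbb{F}_{q^2}[x_0,x_1,x_2,x_3]$ be a nonzero homogeneous polynomial of degree $d$ with $1\le d\le q$. Then $$|(P\mathcal{U}_2\cap V(F))(\mathbb{F}_{q^2})|=1+q^2d(q+1)$$ if and only if $V(F)$ is a cone with vertex $P$ over a plane curve $\mathcal{C}$ defined over $\mathbb{F}_{q^2}$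 with $|(\mathcal{C}\cap P\mathcal{U}_2)(\mathbb{F}_{q^2})|=d(q+1)$; that is, if and only if there are a plane $E\subset\mathbb{P}^3$ defined over $\mathbb{F}_{q^2}$ with $P\notin E$, and a curve $\mathcal{C}\subset E$ cut out on $E$ by a homogeneous polynomial over $\mathbb{F}_{q^2}$ of positive degree not vanishing identically on $E$, such that $V(F)$ is the union of all lines joining $P$ to a point of $\mathcal{C}$ and $|(\mathcal{C}\cap P\mathcal{U}_2)(\mathbb{F}_{q^2})|=d(q+1)$. -/

import Mathlib

open scoped LinearAlgebra.Projectivization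

noncomputable section

namespace HermitianCone

/-- The set of geometric points of projective `n`-space over the field `K`, i.e. its points over
an algebraic closure of `K`, in homogeneous coordinates `x₀, …, xₙ`. -/
abbrev GeomPoint (K : Type*) [Field K] (n : ℕ) : Type _ :=
  ℙ (AlgebraicClosure K) (Fin (n + 1) → AlgebraicClosure K)

variable {K : Type*} [Field K] {n : ℕ}

/-- `V(F)`: the zero set in projective space (over the algebraic closure) of a polynomial `F` with
coefficients in `K`. It is used for homogeneous `F` only, for which the choice of the
representative `x.rep` is irrelevant. -/
def zeroSet (F : MvPolynomial (Fin (n + 1)) K) : Set (GeomPoint K n) :=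
  {x | MvPolynomial.aeval x.rep F = 0}

/-- The set `Z(K)` of `K`-rational points of `Z`: those points of `Z` that have homogeneous
coordinates in `K`. -/
def rationalPoints (Z : Set (GeomPoint K n)) : Set (GeomPoint K n) :=
  {x | x ∈ Z ∧ ∃ v : Fin (n + 1) → K,
    ∃ hv : (fun i => algebraMap K (AlgebraicClosure K) (v i)) ≠ 0,
      x = Projectivization.mk (AlgebraicClosure K) _ hv}

/-- A Hermitian matrix over a field with `q ^ 2` elements: `H ≠ 0` and `h_ij = h_ji ^ q`. -/
def IsHermitianMatrix (q : ℕ) (H : Matrix (Fin (n + 1)) (Fin (n + 1)) K) : Prop :=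
  H ≠ 0 ∧ ∀ i j, H i j = H j i ^ q

/-- The polynomial `xᵀ H x^(q) = ∑ h_ij x_i x_j ^ q`. -/
def hermitianPoly (q : ℕ) (H : Matrix (Fin (n + 1)) (Fin (n + 1)) K) :
    MvPolynomial (Fin (n + 1)) K :=
  ∑ i, ∑ j, MvPolynomial.C (H i j) * MvPolynomial.X i * MvPolynomial.X j ^ q

/-- The Hermitian variety of `H`. -/
def hermitianVariety (q : ℕ) (H : Matrix (Fin (n + 1)) (Fin (n + 1)) K) :
    Set (GeomPoint K n) :=
  zeroSet (hermitianPoly q H)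

/-- The singular space of the Hermitian variety of `H`: the points `x` with `xᵀ H = 0`.
If `H` is a Hermitian matrix of size `n + 1` and rank `n`, this is a single point, rational over
`K`: the vertex of the cone that the Hermitian variety is. -/
def singularSpace (H : Matrix (Fin (n + 1)) (Fin (n + 1)) K) : Set (GeomPoint K n) :=
  {x | Matrix.vecMul x.rep (H.map (algebraMap K (AlgebraicClosure K))) = 0}

/-- A hyperplane defined over `K` (a plane, for `n = 3`). -/
def IsHyperplane (E : Set (GeomPoint K n)) : Prop :=
  ∃ l : MvPolynomial (Fin (n + 1)) K, l.IsHomogeneous 1 ∧ l ≠ 0 ∧ E = zeroSet l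

/-- `C` is a hypersurface of `E`, defined over `K`: it is cut out on `E` by a form over `K` of
positive degree that does not vanish identically on `E`. For a plane `E` defined over `K`
this says that `C` is a plane curve in `E`, defined over `K`. -/
def IsHypersurfaceIn (E C : Set (GeomPoint K n)) : Prop :=
  ∃ (e : ℕ) (G : MvPolynomial (Fin (n + 1)) K),
    0 < e ∧ G.IsHomogeneous e ∧ ¬ E ⊆ zeroSet G ∧ C = E ∩ zeroSet G

/-- The cone over `C` with vertex `P`: the union of the lines joining `P` to the points of `C`. -/
def cone (P : GeomPoint K n) (C : Set (GeomPoint K n)) : Set (GeomPoint K n) :=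
  {x | ∃ y ∈ C, x.submodule ≤ P.submodule ⊔ y.submodule}

end HermitianCone

end

/-!
Normalise the vertex `p` so that `p i = 1`, and write a vector as `y + t p` with `y` in the
hyperplane `x_i = 0`. The Hermitian form depends on `y` only, and its restriction to the hyperplane
is nondegenerate, so it defines a Hermitian curve with an irreducible equation.

Let `m` be the degree of `F (y + t p)` in `t`. If `m = 0`, then `V(F)` is a cone with vertex `p`,
and each point of the base curve contributes `q ^ 2` points besides the vertex. If `m ≥ 1`, the
leading coefficient in `t` is a form of degree `d - m` in `y`. By Bézout it vanishes at no more than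
`(q + 1) (d - m)` points of the Hermitian curve; over any other point of that curve, `F` has at most
`m` zeros on the line to the vertex. Summing over the curve yields strictly fewer than
`1 + q ^ 2 d (q + 1)` points.
-/

namespace HermitianCone

open Matrix MvPolynomial

section Homogeneous

variable {σ K : Type*} [Field K]

theorem isHomogeneous_totalDegree_of_le_order {p : MvPolynomial σ K}
    (hp : p.totalDegree ≤ (p : MvPowerSeries σ K).order) : p.IsHomogeneous p.totalDegree := by
  intro s hs
  rw [Pi.one_def, ← Finsupp.degree_eq_weight_one]
  refine le_antisymm (le_totalDegree (mem_support_iff.2 hs)) ?_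
  exact_mod_cast hp.trans (MvPowerSeries.order_le (by rwa [coeff_coe]))

theorem order_le_totalDegree {p : MvPolynomial σ K} (hp : p ≠ 0) :
    (p : MvPowerSeries σ K).order ≤ p.totalDegree := by
  obtain ⟨s, hs⟩ := ne_zero_iff.1 hp
  exact (MvPowerSeries.order_le (by rwa [coeff_coe])).trans
    (by exact_mod_cast le_totalDegree (mem_support_iff.2 hs))

theorem le_order_of_isHomogeneous {p : MvPolynomial σ K} {n : ℕ} (hp : p.IsHomogeneous n) :
    n ≤ (p : MvPowerSeries σ K).order :=
  MvPowerSeries.le_order fun s hs => by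
    rw [coeff_coe]
    exact hp.coeff_eq_zero (by exact_mod_cast hs.ne)

theorem isHomogeneous_totalDegree_of_mul {A B : MvPolynomial σ K} {n : ℕ}
    (h : (A * B).IsHomogeneous n) (h0 : A * B ≠ 0) : A.IsHomogeneous A.totalDegree := by
  have hA := left_ne_zero_of_mul h0
  have hB := right_ne_zero_of_mul h0
  refine isHomogeneous_totalDegree_of_le_order ?_
  have hdeg : A.totalDegree + B.totalDegree = n := by
    rw [← totalDegree_mul_of_isDomain hA hB, h.totalDegree h0]
  have hord := le_order_of_isHomogeneous h
  rw [coe_mul, MvPowerSeries.order_mul, ← hdeg, Nat.cast_add] at hord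
  have hBord := order_le_totalDegree hB
  refine (ENat.add_le_add_iff_right (ENat.natCast_ne_top B.totalDegree)).1 ?_
  exact hord.trans (by gcongr)

theorem isHomogeneous_of_mul_left {A B : MvPolynomial σ K} {a n : ℕ} (hA : A.IsHomogeneous a)
    (hA0 : A ≠ 0) (h : (A * B).IsHomogeneous (a + n)) : B.IsHomogeneous n := by
  rcases eq_or_ne B 0 with rfl | hB0
  · exact isHomogeneous_zero ..
  have hAB := mul_ne_zero hA0 hB0
  have hdeg := totalDegree_mul_of_isDomain hA0 hB0
  rw [h.totalDegree hAB, hA.totalDegree hA0, add_right_inj] at hdeg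
  rw [hdeg]
  exact isHomogeneous_totalDegree_of_mul (mul_comm A B ▸ h) (mul_comm A B ▸ hAB)

theorem isUnit_of_totalDegree_eq_zero {p : MvPolynomial σ K} (hp : p.totalDegree = 0)
    (h0 : p ≠ 0) : IsUnit p := by
  rw [totalDegree_eq_zero_iff_eq_C] at hp
  rw [hp] at h0 ⊢
  exact IsUnit.map C (isUnit_iff_ne_zero.2 fun h => h0 (by rw [h, map_zero]))

theorem aeval_smul_of_isHomogeneous {A : Type*} [CommRing A] [Algebra K A]
    {p : MvPolynomial σ K} {n : ℕ} (hp : p.IsHomogeneous n) (c : A) (v : σ → A) :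
    aeval (c • v) p = c ^ n * aeval v p := by
  simp only [p.aeval_def, eval₂_eq, Finset.mul_sum]
  refine Finset.sum_congr rfl fun s hs => ?_
  have hdeg : ∑ i ∈ s.support, s i = n := by
    rw [← Finsupp.degree_apply]
    exact not_imp_comm.1 hp.coeff_eq_zero (mem_support_iff.1 hs)
  simp only [Pi.smul_apply, smul_eq_mul, mul_pow, Finset.prod_mul_distrib,
    Finset.prod_pow_eq_pow_sum, hdeg]
  ring

instance finiteDimensional_homogeneousSubmodule [Finite σ] (n : ℕ) :
    FiniteDimensional K (homogeneousSubmodule σ K n) :=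
  Module.Finite.of_fg (homogeneousSubmodule_fg σ K n)

theorem finrank_homogeneousSubmodule [Fintype σ] (n : ℕ) :
    Module.finrank K (homogeneousSubmodule σ K n) = (Fintype.card σ + n - 1).choose n := by
  classical
  have hmonomials : {s : σ →₀ ℕ | s.degree = n} =
      (Finset.univ : Finset σ).finsuppAntidiag n := by
    ext s
    simp [Finset.mem_finsuppAntidiag, Finsupp.degree_eq_sum]
  rw [homogeneousSubmodule_eq_finsupp_supported,
    (AddMonoidAlgebra.supportedEquivFinsupp {s : σ →₀ ℕ | s.degree = n}).finrank_eq, hmonomials,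
    Module.finrank_finsupp_self]
  simp [Finset.card_finsuppAntidiag_nat_eq_choose]

theorem two_mul_finrank_homogeneousSubmodule_fin_three (n : ℕ) :
    2 * Module.finrank K (homogeneousSubmodule (Fin 3) K n) = (n + 2) * (n + 1) := by
  rw [finrank_homogeneousSubmodule, Fintype.card_fin, show 3 + n - 1 = n + 2 by omega,
    Nat.choose_symm_add, Nat.choose_two_right,
    Nat.mul_div_cancel' (Nat.even_mul_pred_self (n + 2)).two_dvd]
  rfl

end Homogeneous

section Bezout

variable {σ K : Type*} [Field K]

/-- The space of the products of `A` with the forms of degree `n`: the degree `n + deg A` part of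
the ideal `(A)`, when `A` is homogeneous. -/
noncomputable def formMultiples (A : MvPolynomial σ K) (n : ℕ) : Submodule K (MvPolynomial σ K) :=
  (homogeneousSubmodule σ K n).map (LinearMap.mulLeft K A)

instance finiteDimensional_formMultiples [Finite σ] (A : MvPolynomial σ K) (n : ℕ) :
    FiniteDimensional K (formMultiples A n) :=
  inferInstanceAs (FiniteDimensional K ((homogeneousSubmodule σ K n).map (LinearMap.mulLeft K A)))

theorem finrank_formMultiples {A : MvPolynomial σ K} (hA : A ≠ 0) (n : ℕ) :
    Module.finrank K (formMultiples A n) = Module.finrank K (homogeneousSubmodule σ K n) :=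
  (Submodule.equivMapOfInjective _ (mul_right_injective₀ hA) _).finrank_eq.symm

theorem formMultiples_le {A : MvPolynomial σ K} {a n N : ℕ} (hA : A.IsHomogeneous a)
    (h : a + n = N) : formMultiples A n ≤ homogeneousSubmodule σ K N := by
  rintro _ ⟨g, hg, rfl⟩
  exact h ▸ hA.mul hg

theorem formMultiples_inf_le {A B : MvPolynomial σ K} {a : ℕ} (hA : A.IsHomogeneous a)
    (hA0 : A ≠ 0) (hAB : IsRelPrime A B) (m s : ℕ) :
    formMultiples A m ⊓ formMultiples B (s + a) ≤ formMultiples (A * B) s := by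
  rintro _ ⟨⟨g, -, rfl⟩, ⟨k, hk, hgk⟩⟩
  simp only [LinearMap.mulLeft_apply] at hgk ⊢
  obtain ⟨c, rfl⟩ : A ∣ k := hAB.dvd_of_dvd_mul_left ⟨g, hgk⟩
  refine ⟨c, isHomogeneous_of_mul_left hA hA0 (add_comm s a ▸ hk), ?_⟩
  rw [LinearMap.mulLeft_apply, ← hgk]
  ring

theorem finrank_homogeneousSubmodule_le_finrank_sup_add_mul {A B : MvPolynomial (Fin 3) K}
    {a b : ℕ} (hA : A.IsHomogeneous a) (hA0 : A ≠ 0) (hB0 : B ≠ 0) (hAB : IsRelPrime A B) (s : ℕ) :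
    Module.finrank K (homogeneousSubmodule (Fin 3) K (s + a + b)) ≤
      Module.finrank K ↥(formMultiples A (s + b) ⊔ formMultiples B (s + a)) + a * b := by
  have hsum := Submodule.finrank_sup_add_finrank_inf_eq
    (formMultiples A (s + b)) (formMultiples B (s + a))
  have hinf := Submodule.finrank_mono (formMultiples_inf_le hA hA0 hAB (s + b) s)
  simp only [finrank_formMultiples, hA0, hB0, mul_ne_zero, ne_eq, not_false_eq_true] at hsum hinf
  have hN := two_mul_finrank_homogeneousSubmodule_fin_three (K := K) (s + a + b)
  have hs := two_mul_finrank_homogeneousSubmodule_fin_three (K := K) s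
  have hsa := two_mul_finrank_homogeneousSubmodule_fin_three (K := K) (s + a)
  have hsb := two_mul_finrank_homogeneousSubmodule_fin_three (K := K) (s + b)
  nlinarith

/-- Evaluation of forms of degree `n` at fixed representatives of the points of `S`. -/
noncomputable def evalForms (S : Finset (ℙ K (σ → K))) (n : ℕ) :
    homogeneousSubmodule σ K n →ₗ[K] (S → K) :=
  (LinearMap.pi fun x : S => (aeval x.1.rep).toLinearMap).domRestrict _

theorem evalForms_apply (S : Finset (ℙ K (σ → K))) {n : ℕ} (g : homogeneousSubmodule σ K n)
    (x : S) : evalForms S n g x = eval x.1.rep g.1 :=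
  rfl

theorem exists_linearForm_separating {x y : ℙ K (σ → K)} (hxy : y ≠ x) :
    ∃ l : MvPolynomial σ K, l.IsHomogeneous 1 ∧ eval x.rep l ≠ 0 ∧ eval y.rep l = 0 := by
  obtain ⟨j, hj⟩ := Function.ne_iff.1 y.rep_nonzero
  have hminor : ∃ k, y.rep j * x.rep k ≠ y.rep k * x.rep j := by
    by_contra! h
    refine hxy.symm ?_
    rw [← x.mk_rep, ← y.mk_rep, Projectivization.mk_eq_mk_iff']
    refine ⟨x.rep j / y.rep j, funext fun k => ?_⟩
    rw [Pi.smul_apply, smul_eq_mul, div_mul_eq_mul_div, div_eq_iff hj, mul_comm, ← h k, mul_comm]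
  obtain ⟨k, hk⟩ := hminor
  refine ⟨C (y.rep j) * X k - C (y.rep k) * X j,
    (isHomogeneous_C_mul_X _ _).sub (isHomogeneous_C_mul_X _ _), ?_, ?_⟩
  · simpa [sub_eq_zero] using hk
  · simp [mul_comm]

theorem exists_form_separating (S : Finset (ℙ K (σ → K))) (x : ℙ K (σ → K)) {n : ℕ}
    (hn : S.card ≤ n) :
    ∃ g : MvPolynomial σ K, g.IsHomogeneous n ∧ eval x.rep g ≠ 0 ∧
      ∀ y ∈ S, y ≠ x → eval y.rep g = 0 := by
  classical
  obtain ⟨k, hk⟩ := Function.ne_iff.1 x.rep_nonzero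
  have hsep (y : ℙ K (σ → K)) : ∃ l : MvPolynomial σ K, l.IsHomogeneous 1 ∧ eval x.rep l ≠ 0 ∧
      (y ≠ x → eval y.rep l = 0) := by
    by_cases hy : y = x
    · exact ⟨X k, isHomogeneous_X _ _, by simpa using hk, fun h => absurd hy h⟩
    · obtain ⟨l, hl, hlx, hly⟩ := exists_linearForm_separating hy
      exact ⟨l, hl, hlx, fun _ => hly⟩
  choose l hl hlx hly using hsep
  refine ⟨(∏ y ∈ S, l y) * X k ^ (n - S.card), ?_, ?_, fun y hy hyx => ?_⟩
  · have hprod := (IsHomogeneous.prod S l (fun _ => 1) fun y _ => hl y).mul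
      (isHomogeneous_X_pow (R := K) k (n - S.card))
    rwa [Finset.sum_const, smul_eq_mul, mul_one, Nat.add_sub_cancel' hn] at hprod
  · have hxk : x.rep k ≠ 0 := hk
    simp [map_prod, Finset.prod_ne_zero_iff, hlx, hxk]
  · rw [map_mul, map_prod, Finset.prod_eq_zero hy (hly y hyx), zero_mul]

theorem range_evalForms (S : Finset (ℙ K (σ → K))) {n : ℕ} (hn : S.card ≤ n) :
    LinearMap.range (evalForms S n) = ⊤ := by
  classical
  rw [eq_top_iff, ← (Pi.basisFun K S).span_eq, Submodule.span_le]
  rintro _ ⟨x, rfl⟩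
  obtain ⟨g, hg, hgx, hgy⟩ := exists_form_separating S x.1 hn
  refine ⟨(eval x.1.rep g)⁻¹ • ⟨g, hg⟩, ?_⟩
  ext y
  rw [map_smul, Pi.smul_apply, evalForms_apply, Pi.basisFun_apply]
  rcases eq_or_ne y x with rfl | hyx
  · simp [hgx]
  · have hgy0 : eval y.1.rep g = 0 := hgy y.1 y.2 fun h => hyx (Subtype.ext h)
    simp [hgy0, hyx]

theorem card_le_mul_of_forall_eval_eq_zero {A B : MvPolynomial (Fin 3) K} {a b : ℕ}
    (hA : A.IsHomogeneous a) (hB : B.IsHomogeneous b) (hA0 : A ≠ 0) (hB0 : B ≠ 0)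
    (hAB : IsRelPrime A B) (S : Finset (ℙ K (Fin 3 → K)))
    (hS : ∀ x ∈ S, eval x.rep A = 0 ∧ eval x.rep B = 0) : S.card ≤ a * b := by
  set N := S.card + a + b
  have hrange := LinearMap.finrank_range_add_finrank_ker (evalForms S N)
  rw [range_evalForms S (by omega), finrank_top, Module.finrank_fintype_fun_eq_card,
    Fintype.card_coe] at hrange
  have hle : formMultiples A (S.card + b) ⊔ formMultiples B (S.card + a) ≤
      (LinearMap.ker (evalForms S N)).map (homogeneousSubmodule (Fin 3) K N).subtype := by
    rintro p hp
    have hpN : p.IsHomogeneous N := sup_le (formMultiples_le hA (by omega))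
      (formMultiples_le hB (by omega)) hp
    refine ⟨⟨p, hpN⟩, ?_, rfl⟩
    obtain ⟨_, ⟨g, -, rfl⟩, _, ⟨k, -, rfl⟩, rfl⟩ := Submodule.mem_sup.1 hp
    ext x
    simp [evalForms_apply, hS x.1 x.2]
  have hker := Submodule.finrank_mono hle
  rw [Submodule.finrank_map_subtype_eq] at hker
  have hdim : Module.finrank K (homogeneousSubmodule (Fin 3) K N) ≤ _ :=
    finrank_homogeneousSubmodule_le_finrank_sup_add_mul hA hA0 hB0 hAB S.card
  omega

end Bezout

section Irreducible

section Height

variable {R : Type*} [CommRing R] {n : ℕ}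

/-- The prime ideal `(X₀, …, Xₖ₋₁)`, as the kernel of the map that kills these variables. -/
noncomputable def firstVariablesIdeal (R : Type*) [CommRing R] (n k : ℕ) :
    Ideal (MvPolynomial (Fin n) R) :=
  RingHom.ker (aeval fun i : Fin n => if i < k then (0 : MvPolynomial (Fin n) R) else X i)

theorem X_mem_firstVariablesIdeal [Nontrivial R] {k : ℕ} {i : Fin n} :
    X i ∈ firstVariablesIdeal R n k ↔ i < k := by
  simp [firstVariablesIdeal, RingHom.mem_ker]

theorem mem_firstVariablesIdeal_self {p : MvPolynomial (Fin n) R} :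
    p ∈ firstVariablesIdeal R n n ↔ constantCoeff p = 0 := by
  simp only [firstVariablesIdeal, RingHom.mem_ker, Fin.is_lt, if_true, aeval_zero']
  exact map_eq_zero_iff C (C_injective (Fin n) R)

theorem firstVariablesIdeal_le {P : Ideal (MvPolynomial (Fin n) R)} {k : ℕ}
    (hP : ∀ i : Fin n, i < k → X i ∈ P) : firstVariablesIdeal R n k ≤ P := by
  intro p hp
  have hmk : (Ideal.Quotient.mkₐ R P).comp
      (aeval fun i : Fin n => if i < k then (0 : MvPolynomial (Fin n) R) else X i) =
        Ideal.Quotient.mkₐ R P := by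
    refine algHom_ext fun i => ?_
    rw [AlgHom.comp_apply, aeval_X]
    split_ifs with hi
    · rw [map_zero, Ideal.Quotient.mkₐ_eq_mk, Ideal.Quotient.eq_zero_iff_mem.2 (hP i hi)]
    · rfl
  rw [← Ideal.Quotient.eq_zero_iff_mem, ← Ideal.Quotient.mkₐ_eq_mk R, ← hmk, AlgHom.comp_apply]
  exact (congrArg _ (RingHom.mem_ker.1 hp)).trans (map_zero _)

variable [IsDomain R]

instance isPrime_firstVariablesIdeal (k : ℕ) : (firstVariablesIdeal R n k).IsPrime :=
  RingHom.ker_isPrime _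

theorem le_height_firstVariablesIdeal {k : ℕ} (hk : k ≤ n) :
    k ≤ (firstVariablesIdeal R n k).height := by
  induction k with
  | zero => simp
  | succ k ih =>
    have hle : firstVariablesIdeal R n k ≤ firstVariablesIdeal R n (k + 1) :=
      firstVariablesIdeal_le fun i hi => X_mem_firstVariablesIdeal.2 (by omega)
    have hlt : firstVariablesIdeal R n k < firstVariablesIdeal R n (k + 1) := by
      refine lt_of_le_not_ge hle fun hge => ?_
      have hX := hge (X_mem_firstVariablesIdeal (i := ⟨k, hk⟩).2 k.lt_succ_self)
      exact lt_irrefl k (X_mem_firstVariablesIdeal.1 hX)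
    rw [Nat.cast_succ]
    grw [ih (by omega)]
    exact Ideal.height_add_one_le_of_lt_of_isPrime hlt

theorem le_ncard_of_forall_X_pow_mem_span [IsNoetherianRing R]
    {s : Set (MvPolynomial (Fin n) R)} (hfin : s.Finite) (hs : ∀ p ∈ s, constantCoeff p = 0) {q : ℕ}
    (hX : ∀ i, X i ^ q ∈ Ideal.span s) : n ≤ s.ncard := by
  have hmin : firstVariablesIdeal R n n ∈ (Ideal.span s).minimalPrimes :=
    ⟨⟨inferInstance, Ideal.span_le.2 fun p hp => mem_firstVariablesIdeal_self.2 (hs p hp)⟩,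
      fun P ⟨hP, hle⟩ _ => firstVariablesIdeal_le fun i _ => hP.mem_of_pow_mem q (hle (hX i))⟩
  exact_mod_cast (le_height_firstVariablesIdeal le_rfl).trans
    (Ideal.height_le_card_of_mem_minimalPrimes_span hfin hmin)

end Height

section Hermitian

variable {K : Type*} [Field K] {q n : ℕ}

theorem hermitianPoly_isHomogeneous (q : ℕ) (H : Matrix (Fin (n + 1)) (Fin (n + 1)) K) :
    (hermitianPoly q H).IsHomogeneous (q + 1) := by
  refine IsHomogeneous.sum _ _ _ fun i _ => IsHomogeneous.sum _ _ _ fun j _ => ?_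
  exact add_comm 1 q ▸ (isHomogeneous_C_mul_X (H i j) i).mul (isHomogeneous_X_pow j q)

theorem pderiv_hermitianPoly (hq : (q : K) = 0) (H : Matrix (Fin (n + 1)) (Fin (n + 1)) K)
    (i : Fin (n + 1)) : pderiv i (hermitianPoly q H) = ∑ j, C (H i j) * X j ^ q := by
  have hq' : (q : MvPolynomial (Fin (n + 1)) K) = 0 := by
    rw [← map_natCast (C : K →+* MvPolynomial (Fin (n + 1)) K), hq, map_zero]
  simp [hermitianPoly, Derivation.leibniz_pow, hq', pderiv_X, Pi.single_apply, mul_comm]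

theorem sum_inv_mul_pderiv_hermitianPoly (hq : (q : K) = 0)
    {H : Matrix (Fin (n + 1)) (Fin (n + 1)) K} (hdet : IsUnit H.det) (m : Fin (n + 1)) :
    ∑ i, C (H⁻¹ m i) * pderiv i (hermitianPoly q H) = X m ^ q := by
  have hinv (j : Fin (n + 1)) : ∑ i, H⁻¹ m i * H i j = if m = j then 1 else 0 := by
    rw [← Matrix.mul_apply, Matrix.nonsing_inv_mul H hdet, Matrix.one_apply]
  simp_rw [pderiv_hermitianPoly hq, Finset.mul_sum, ← mul_assoc, ← C_mul]
  rw [Finset.sum_comm]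
  simp_rw [← Finset.sum_mul, ← map_sum, hinv]
  simp

theorem hermitianPoly_ne_zero (hq : (q : K) = 0)
    {H : Matrix (Fin (n + 1)) (Fin (n + 1)) K} (hdet : IsUnit H.det) : hermitianPoly q H ≠ 0 := by
  intro h
  have hX := sum_inv_mul_pderiv_hermitianPoly hq hdet 0
  simp only [h, map_zero, mul_zero, Finset.sum_const_zero] at hX
  exact pow_ne_zero _ (X_ne_zero _) hX.symm

theorem constantCoeff_eq_zero_of_isHomogeneous {σ : Type*} {p : MvPolynomial σ K} {m : ℕ}
    (hp : p.IsHomogeneous m) (hm : m ≠ 0) : constantCoeff p = 0 :=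
  hp.coeff_eq_zero (by simpa using hm.symm)

/-- In a factorization `A * B` of the form, the partial derivatives lie in `(A, B)`, hence so do the
`q`-th powers of the variables; but the origin is not cut out by two equations. -/
theorem irreducible_hermitianPoly (hq : (q : K) = 0) (hn : 2 ≤ n)
    {H : Matrix (Fin (n + 1)) (Fin (n + 1)) K} (hdet : IsUnit H.det) :
    Irreducible (hermitianPoly q H) := by
  have h0 := hermitianPoly_ne_zero hq hdet
  have hhom := hermitianPoly_isHomogeneous q H
  refine ⟨fun hu => ?_, fun A B hAB => ?_⟩
  · exact (hu.map constantCoeff).ne_zero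
      (constantCoeff_eq_zero_of_isHomogeneous hhom q.succ_ne_zero)
  rw [hAB] at hhom h0
  have hA := isHomogeneous_totalDegree_of_mul hhom h0
  have hB := isHomogeneous_totalDegree_of_mul (mul_comm A B ▸ hhom) (mul_comm A B ▸ h0)
  by_contra! hunit
  have hA0 : constantCoeff A = 0 := constantCoeff_eq_zero_of_isHomogeneous hA fun h =>
    hunit.1 (isUnit_of_totalDegree_eq_zero h (left_ne_zero_of_mul h0))
  have hB0 : constantCoeff B = 0 := constantCoeff_eq_zero_of_isHomogeneous hB fun h =>
    hunit.2 (isUnit_of_totalDegree_eq_zero h (right_ne_zero_of_mul h0))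
  have hX (m : Fin (n + 1)) : X m ^ q ∈ Ideal.span {A, B} := by
    rw [← sum_inv_mul_pderiv_hermitianPoly hq hdet m, hAB]
    refine Ideal.sum_mem _ fun i _ => Ideal.mul_mem_left _ _ ?_
    rw [Derivation.leibniz, smul_eq_mul, smul_eq_mul]
    exact Ideal.add_mem _ (Ideal.mul_mem_right _ _ (Ideal.subset_span (by simp)))
      (Ideal.mul_mem_right _ _ (Ideal.subset_span (by simp)))
  have hcard := le_ncard_of_forall_X_pow_mem_span (Set.toFinite _) (by simp [hA0, hB0]) hX
  have := Set.ncard_insert_le A {B}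
  rw [Set.ncard_singleton] at this
  omega

end Hermitian

end Irreducible

section Coordinates

variable {R : Type*} [CommRing R] {n : ℕ}

/-- The inclusion of the coordinate hyperplane `x_i = 0`, with its `n` remaining coordinates. -/
def hyperplaneEmb (i : Fin (n + 1)) : (Fin n → R) →ₗ[R] (Fin (n + 1) → R) where
  toFun y := i.insertNth 0 y
  map_add' y z := by ext k; induction k using i.succAboveCases <;> simp
  map_smul' c y := by ext k; induction k using i.succAboveCases <;> simp

@[simp] theorem hyperplaneEmb_apply_self (i : Fin (n + 1)) (y : Fin n → R) :
    hyperplaneEmb i y i = 0 := by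
  simp [hyperplaneEmb]

@[simp] theorem hyperplaneEmb_apply_succAbove (i : Fin (n + 1)) (y : Fin n → R) (j : Fin n) :
    hyperplaneEmb i y (i.succAbove j) = y j := by
  simp [hyperplaneEmb]

theorem hyperplaneEmb_injective (i : Fin (n + 1)) :
    Function.Injective (hyperplaneEmb i : (Fin n → R) →ₗ[R] _) := fun y z h => by
  ext j
  simpa using congrFun h (i.succAbove j)

/-- The coordinates `(y, t)` of the vector `y + t p`, where `y` lies in the hyperplane `x_i = 0`
and `p_i = 1`. -/
def lineEquiv {p : Fin (n + 1) → R} {i : Fin (n + 1)} (hp : p i = 1) :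
    (Fin n → R) × R ≃ (Fin (n + 1) → R) where
  toFun x := hyperplaneEmb i x.1 + x.2 • p
  invFun v := (fun j => v (i.succAbove j) - v i * p (i.succAbove j), v i)
  left_inv x := by ext j <;> simp [hp]
  right_inv v := by ext k; induction k using i.succAboveCases <;> simp [hp]

theorem exists_hyperplaneEmb_add_smul {p : Fin (n + 1) → R} {i : Fin (n + 1)} (hp : p i = 1)
    (v : Fin (n + 1) → R) : ∃ y, ∃ t : R, hyperplaneEmb i y + t • p = v :=
  ⟨_, _, (lineEquiv hp).apply_symm_apply v⟩

theorem ncard_eq_sum_ncard_line [Fintype R] {p : Fin (n + 1) → R} {i : Fin (n + 1)}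
    (hp : p i = 1) (S : Set (Fin (n + 1) → R)) :
    S.ncard = ∑ y, {t : R | hyperplaneEmb i y + t • p ∈ S}.ncard := by
  classical
  simp_rw [Set.ncard_eq_toFinset_card', Set.toFinset_card, ← Nat.card_eq_fintype_card]
  rw [← Nat.card_sigma]
  exact Nat.card_congr (((lineEquiv hp).subtypeEquiv fun _ => Iff.rfl).symm.trans
    (Equiv.subtypeProdEquivSigmaSubtype fun y t => hyperplaneEmb i y + t • p ∈ S))

end Coordinates

section HermitianForm

theorem two_le_of_card_eq_sq {K : Type*} [Field K] [Fintype K] {q : ℕ}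
    (hK : Fintype.card K = q ^ 2) : 2 ≤ q := by
  have := hK ▸ Fintype.one_lt_card (α := K)
  by_contra! h
  interval_cases q <;> simp_all

/-- The Frobenius map `x ↦ x ^ q` as the involution of a field with `q ^ 2` elements: with it
`hermitianPoly q H` takes the values of the Hermitian form of `H`. -/
@[reducible] def frobeniusStarRing {K : Type*} [Field K] [Fintype K] {q : ℕ}
    (hK : Fintype.card K = q ^ 2) : StarRing K where
  star x := x ^ q
  star_involutive x := by change (x ^ q) ^ q = x; rw [← pow_mul, ← sq, ← hK, FiniteField.pow_card]
  star_mul x y := by rw [mul_pow, mul_comm]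
  star_add x y := by
    obtain ⟨p, hp⟩ := CharP.exists K
    obtain ⟨m, hprime, hm⟩ := FiniteField.card K p
    have : Fact p.Prime := ⟨hprime⟩
    obtain ⟨k, -, rfl⟩ := (Nat.dvd_prime_pow hprime).1 (Dvd.intro q (by rw [← hm, hK, sq]))
    exact add_pow_char_pow x y p k

theorem ncard_setOf_eval_eq_zero_le {K : Type*} [Field K] {f : Polynomial K} (hf : f ≠ 0) :
    {t : K | f.eval t = 0}.ncard ≤ f.natDegree := by
  convert f.ncard_rootSet_le K
  ext t
  simp [Polynomial.mem_rootSet, hf]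

variable {K : Type*} [Field K] [StarRing K]

/-- The isotropic vectors, zero included, of the form `∑ h_ij x_i (star x_j)`. -/
def isotropicVectors {m : Type*} [Fintype m] (H : Matrix m m K) : Set (m → K) :=
  {v | v ⬝ᵥ H *ᵥ star v = 0}

theorem eval_hermitianPoly {n q : ℕ} (hstar : ∀ x : K, star x = x ^ q)
    (H : Matrix (Fin (n + 1)) (Fin (n + 1)) K) (v : Fin (n + 1) → K) :
    eval v (hermitianPoly q H) = v ⬝ᵥ H *ᵥ star v := by
  simp only [hermitianPoly, map_sum, map_mul, map_pow, eval_C, eval_X, dotProduct, mulVec,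
    Finset.mul_sum, Pi.star_apply, hstar]
  exact Finset.sum_congr rfl fun i _ => Finset.sum_congr rfl fun j _ => by ring

section

variable {m : Type*} [Fintype m] {H : Matrix m m K}

theorem mem_isotropicVectors {v : m → K} : v ∈ isotropicVectors H ↔ v ⬝ᵥ H *ᵥ star v = 0 :=
  Iff.rfl

theorem smul_mem_isotropicVectors {v : m → K} (hv : v ∈ isotropicVectors H) (c : K) :
    c • v ∈ isotropicVectors H := by
  rw [mem_isotropicVectors] at hv ⊢
  rw [star_smul, mulVec_smul, smul_dotProduct, dotProduct_smul, hv, smul_zero, smul_zero]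

theorem dotProduct_mulVec_star_add_smul (v p : m → K) (t : K) :
    (v + t • p) ⬝ᵥ H *ᵥ star (v + t • p) =
      v ⬝ᵥ H *ᵥ star v + t * (p ⬝ᵥ H *ᵥ star v) + star t * (v ⬝ᵥ H *ᵥ star p) +
        t * star t * (p ⬝ᵥ H *ᵥ star p) := by
  simp only [star_add, star_smul, mulVec_add, mulVec_smul, add_dotProduct, dotProduct_add,
    smul_dotProduct, dotProduct_smul, smul_eq_mul]
  ring

theorem mulVec_star_eq_zero (hH : H.IsHermitian) {p : m → K} (hp : p ᵥ* H = 0) :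
    H *ᵥ star p = 0 := by
  rw [← star_star (H *ᵥ star p), star_mulVec, star_star, hH.eq, hp, star_zero]

theorem add_smul_mem_isotropicVectors_iff (hH : H.IsHermitian) {p : m → K} (hp : p ᵥ* H = 0)
    (v : m → K) (t : K) : v + t • p ∈ isotropicVectors H ↔ v ∈ isotropicVectors H := by
  rw [mem_isotropicVectors, dotProduct_mulVec_star_add_smul, dotProduct_mulVec p, hp,
    mulVec_star_eq_zero hH hp]
  simp [mem_isotropicVectors]

/-- A totally isotropic subspace of a nondegenerate form has at most half the dimension. -/
theorem two_mul_card_le_of_mul_mul_conjTranspose_eq_zero {ι : Type*} [Fintype ι] [DecidableEq m]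
    (hH : IsUnit H.det) {A : Matrix ι m K} (hA : LinearIndependent K A.row)
    (h : A * H * Aᴴ = 0) : 2 * Fintype.card ι ≤ Fintype.card m := by
  have hA' : LinearIndependent K (A.map star).row :=
    hA.map_of_injective_injective star (starAddEquiv (R := m → K)).toAddMonoidHom
      (fun r hr => star_eq_zero.1 hr) (fun v hv => star_eq_zero.1 hv)
      (fun r v => by simp)
  have hrank := rank_add_rank_le_card_of_mul_eq_zero h
  rw [rank_mul_eq_left_of_isUnit_det H A hH, conjTranspose, transpose_map, rank_transpose,
    hA.rank_matrix, hA'.rank_matrix] at hrank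
  omega

end

section Curve

variable {q : ℕ}

theorem ncard_setOf_isotropicVectors_line_le (hstar : ∀ x : K, star x = x ^ q) (hq : 2 ≤ q)
    {M : Matrix (Fin 3) (Fin 3) K} (hM : IsUnit M.det) {u r : Fin 3 → K}
    (hr : r ∈ isotropicVectors M) (hur : LinearIndependent K ![u, r]) :
    {t : K | u + t • r ∈ isotropicVectors M}.ncard ≤ q := by
  set a := u ⬝ᵥ M *ᵥ star u
  set b := r ⬝ᵥ M *ᵥ star u
  set c := u ⬝ᵥ M *ᵥ star r
  let f : Polynomial K := .C c * .X ^ q + .C b * .X + .C a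
  have hf : f ≠ 0 := by
    intro hf
    have ha0 : a = 0 := by simpa [f, show 0 ≠ q by omega] using congrArg (·.coeff 0) hf
    have hb0 : b = 0 := by
      simpa [f, Polynomial.coeff_X_pow, Polynomial.coeff_C, show 1 ≠ q by omega]
        using congrArg (·.coeff 1) hf
    have hc0 : c = 0 := by simpa [f, ha0, hb0] using hf
    have hspan : Matrix.of ![u, r] * M * (Matrix.of ![u, r])ᴴ = 0 := by
      ext i j
      rw [Matrix.mul_assoc, mul_apply]
      fin_cases i <;> fin_cases j
      exacts [ha0, hc0, hb0, hr]
    simpa using two_mul_card_le_of_mul_mul_conjTranspose_eq_zero hM hur hspan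
  have hdeg : f.natDegree ≤ q := by
    simp only [f]
    compute_degree
    omega
  refine le_trans (le_of_eq ?_) ((ncard_setOf_eval_eq_zero_le hf).trans hdeg)
  congr 1
  ext t
  have heval : f.eval t = a + t * b + t ^ q * c := by
    simp only [f, Polynomial.eval_add, Polynomial.eval_mul, Polynomial.eval_C,
      Polynomial.eval_pow, Polynomial.eval_X]
    ring
  rw [Set.mem_ofPred_eq, Set.mem_ofPred_eq, heval, mem_isotropicVectors,
    dotProduct_mulVec_star_add_smul, mem_isotropicVectors.1 hr, mul_zero, add_zero, hstar]

variable [Fintype K]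

/-- Each of the `q ^ 2 + 1` lines through a point of the curve carries at most `q` further points.
The tangent carries none, so the exact number of points is `q ^ 3 + 1`; the crude bound suffices. -/
theorem ncard_isotropicVectors_le (hK : Fintype.card K = q ^ 2)
    (hstar : ∀ x : K, star x = x ^ q) {M : Matrix (Fin 3) (Fin 3) K} (hM : IsUnit M.det) :
    (isotropicVectors M).ncard ≤ 1 + (q ^ 2 - 1) * (q ^ 3 + q + 1) := by
  classical
  have hq := two_le_of_card_eq_sq hK
  by_cases h : isotropicVectors M ⊆ {0}
  · exact (Set.ncard_le_ncard h).trans (by simp)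
  obtain ⟨s, hs, hs0⟩ := Set.not_subset.1 h
  obtain ⟨i, hi⟩ := Function.ne_iff.1 hs0
  have hr : (s i)⁻¹ • s ∈ isotropicVectors M := smul_mem_isotropicVectors hs _
  have hri : ((s i)⁻¹ • s) i = 1 := inv_mul_cancel₀ hi
  generalize (s i)⁻¹ • s = r at hr hri
  rw [ncard_eq_sum_ncard_line hri, ← Finset.add_sum_erase _ _ (Finset.mem_univ 0)]
  have hzero : {t : K | hyperplaneEmb i 0 + t • r ∈ isotropicVectors M}.ncard ≤ q ^ 2 := by
    rw [← hK, ← Nat.card_eq_fintype_card]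
    exact Set.ncard_le_card _
  have hne : ∀ y ∈ Finset.univ.erase (0 : Fin 2 → K),
      {t : K | hyperplaneEmb i y + t • r ∈ isotropicVectors M}.ncard ≤ q := by
    intro y hy
    refine ncard_setOf_isotropicVectors_line_le hstar hq hM hr (LinearIndependent.pair_iff.2 ?_)
    intro a b hab
    have hb : b = 0 := by simpa [hri] using congrFun hab i
    rw [hb, zero_smul, add_zero, smul_eq_zero,
      map_eq_zero_iff _ (hyperplaneEmb_injective i)] at hab
    exact ⟨hab.resolve_right (Finset.ne_of_mem_erase hy), hb⟩
  refine (add_le_add hzero (Finset.sum_le_card_nsmul _ _ _ hne)).trans (le_of_eq ?_)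
  rw [Finset.card_erase_of_mem (Finset.mem_univ _), Finset.card_univ, Fintype.card_fun, hK,
    Fintype.card_fin, smul_eq_mul, ← pow_mul]
  have h2 : 1 ≤ q ^ 2 := Nat.one_le_pow _ _ (by omega)
  have h4 : 1 ≤ q ^ (2 * 2) := Nat.one_le_pow _ _ (by omega)
  zify [h2, h4]
  ring

end Curve

end HermitianForm

section AffineCone

variable {k V : Type*} [Field k] [AddCommGroup V] [Module k V] {S : Set (ℙ k V)}

/-- The affine cone over a set of points of a projective space: the vectors that represent these
points, and `0`. Counting vectors in affine cones replaces counting points. -/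
def affineCone (S : Set (ℙ k V)) : Set V :=
  {v | ∀ hv : v ≠ 0, Projectivization.mk k v hv ∈ S}

theorem zero_mem_affineCone : (0 : V) ∈ affineCone S := fun h => (h rfl).elim

theorem rep_mem_affineCone_iff {x : ℙ k V} : x.rep ∈ affineCone S ↔ x ∈ S :=
  ⟨fun h => x.mk_rep ▸ h x.rep_nonzero, fun h _ => x.mk_rep.symm ▸ h⟩

theorem affineCone_inter (S T : Set (ℙ k V)) :
    affineCone (S ∩ T) = affineCone S ∩ affineCone T :=
  Set.ext fun _ => forall_and

theorem smul_mem_affineCone {v : V} (hv : v ∈ affineCone S) (c : k) : c • v ∈ affineCone S := by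
  intro hcv
  have hv0 := right_ne_zero_of_smul hcv
  rw [(Projectivization.mk_eq_mk_iff' k _ v hcv hv0).2 ⟨c, rfl⟩]
  exact hv hv0

theorem ncard_affineCone [Finite V] (S : Set (ℙ k V)) :
    (affineCone S).ncard = 1 + (Nat.card k - 1) * S.ncard := by
  let e := Projectivization.nonZeroEquivProjectivizationProdUnits k V
  have he : ∀ v, (e v).1 = Projectivization.mk k v.1 v.2 := fun v => rfl
  have hmem : ∀ v : {v : V // v ≠ 0}, v.1 ∈ affineCone S ↔ e v ∈ S ×ˢ Set.univ := fun v => by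
    simp [affineCone, he, v.2]
  have hins : affineCone S = insert 0 (Subtype.val '' (e ⁻¹' S ×ˢ Set.univ)) := by
    ext v
    by_cases hv : v = 0
    · simp [hv, zero_mem_affineCone]
    · simpa [hv] using hmem ⟨v, hv⟩
  rw [hins, Set.ncard_insert_of_notMem (by simp), Set.ncard_image_of_injective _
    Subtype.val_injective, Set.ncard_preimage_of_injective_subset_range e.injective (by simp),
    Set.ncard_prod, Set.ncard_univ, Nat.card_units]
  ring

theorem ncard_eq_card_mul_ncard_of_add_smul_mem_iff {l : Module.Dual k V} {p : V}
    (hp : l p ≠ 0) {S T : Set V} (hT : ∀ y ∈ T, l y = 0)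
    (hS : ∀ y (t : k), l y = 0 → (y + t • p ∈ S ↔ y ∈ T)) : S.ncard = Nat.card k * T.ncard := by
  have himage : S = (fun x : V × k => x.1 + x.2 • p) '' T ×ˢ Set.univ := by
    ext v
    constructor
    · intro hv
      have hv' : v - (l v / l p) • p + (l v / l p) • p = v := sub_add_cancel _ _
      refine ⟨(_, _), ⟨(hS _ (l v / l p) ?_).1 (hv'.symm ▸ hv), trivial⟩, hv'⟩
      simp [hp]
    · rintro ⟨⟨y, t⟩, ⟨hy, -⟩, rfl⟩
      exact (hS y t (hT y hy)).2 hy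
  rw [himage, Set.InjOn.ncard_image, Set.ncard_prod, Set.ncard_univ, mul_comm]
  rintro ⟨y, t⟩ ⟨hy, -⟩ ⟨z, s⟩ ⟨hz, -⟩ (h : y + t • p = z + s • p)
  have hts : t = s := by simpa [hT y hy, hT z hz, hp] using congrArg l h
  subst hts
  rw [add_right_cancel h]

end AffineCone

section Geometric

variable {K : Type*} [Field K] {n : ℕ}

/-- The inclusion of the vectors over `K` in the vectors over its algebraic closure. -/
noncomputable def toClosure : (Fin (n + 1) → K) →ₛₗ[algebraMap K (AlgebraicClosure K)]
    (Fin (n + 1) → AlgebraicClosure K) where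
  toFun v i := algebraMap K (AlgebraicClosure K) (v i)
  map_add' _ _ := funext fun _ => map_add _ _ _
  map_smul' _ _ := funext fun _ => map_mul _ _ _

@[simp] theorem toClosure_apply (v : Fin (n + 1) → K) (i : Fin (n + 1)) :
    toClosure v i = algebraMap K (AlgebraicClosure K) (v i) := rfl

theorem toClosure_injective :
    Function.Injective (toClosure : (Fin (n + 1) → K) →ₛₗ[algebraMap K (AlgebraicClosure K)] _) :=
  (algebraMap K (AlgebraicClosure K)).injective.comp_left

theorem aeval_toClosure (v : Fin (n + 1) → K) (F : MvPolynomial (Fin (n + 1)) K) :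
    aeval (toClosure v) F = algebraMap K (AlgebraicClosure K) (eval v F) := by
  rw [← aeval_eq_eval]
  exact aeval_algebraMap_apply _ v F

/-- The inclusion of the projective space over `K` in the one over its algebraic closure. -/
noncomputable def pointOfRational : ℙ K (Fin (n + 1) → K) → GeomPoint K n :=
  Projectivization.map toClosure toClosure_injective

theorem pointOfRational_injective :
    Function.Injective (pointOfRational : ℙ K (Fin (n + 1) → K) → GeomPoint K n) := by
  intro x y hxy
  induction x with | h v hv =>
  induction y with | h w hw =>
  obtain ⟨c, hc⟩ := (Projectivization.mk_eq_mk_iff' _ _ _ _ _).1 hxy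
  obtain ⟨i, hi⟩ := Function.ne_iff.1 hw
  have hci : c = algebraMap K (AlgebraicClosure K) (v i / w i) := by
    rw [map_div₀, eq_div_iff (by simpa using hi)]
    exact congrFun hc i
  rw [Projectivization.mk_eq_mk_iff']
  refine ⟨v i / w i, toClosure_injective ?_⟩
  rw [map_smulₛₗ, ← hci, hc]

theorem rationalPoints_eq_image (Z : Set (GeomPoint K n)) :
    rationalPoints Z = pointOfRational '' (pointOfRational ⁻¹' Z) := by
  ext x
  constructor
  · rintro ⟨hx, v, hv, rfl⟩
    have hv0 : v ≠ 0 := fun h => hv (congrArg toClosure h |>.trans (map_zero _))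
    exact ⟨Projectivization.mk K v hv0, hx, rfl⟩
  · rintro ⟨y, hy, rfl⟩
    induction y with | h v hv =>
    exact ⟨hy, v, (map_ne_zero_iff _ toClosure_injective).2 hv, rfl⟩

theorem ncard_toClosure_preimage_affineCone [Finite K] (Z : Set (GeomPoint K n)) :
    (toClosure ⁻¹' affineCone Z).ncard = 1 + (Nat.card K - 1) * (rationalPoints Z).ncard := by
  have h : toClosure ⁻¹' affineCone Z = affineCone (pointOfRational ⁻¹' Z) := by
    ext v
    exact forall_prop_congr (fun _ => Iff.rfl) (map_ne_zero_iff toClosure toClosure_injective)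
  rw [h, ncard_affineCone, rationalPoints_eq_image,
    Set.ncard_image_of_injective _ pointOfRational_injective]

theorem mk_mem_zeroSet_iff {F : MvPolynomial (Fin (n + 1)) K} {d : ℕ} (hF : F.IsHomogeneous d)
    {w : Fin (n + 1) → AlgebraicClosure K} (hw : w ≠ 0) :
    (Projectivization.mk (AlgebraicClosure K) w hw : GeomPoint K n) ∈ zeroSet F ↔
      aeval w F = 0 := by
  obtain ⟨a, ha⟩ := Projectivization.exists_smul_eq_mk_rep (AlgebraicClosure K) w hw
  rw [zeroSet, Set.mem_ofPred_eq, ← ha, Units.smul_def, aeval_smul_of_isHomogeneous hF,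
    mul_eq_zero, or_iff_right (pow_ne_zero _ a.ne_zero)]

theorem mk_toClosure_mem_zeroSet_iff {F : MvPolynomial (Fin (n + 1)) K} {d : ℕ}
    (hF : F.IsHomogeneous d) {p : Fin (n + 1) → K} (hp0 : toClosure p ≠ 0) :
    Projectivization.mk (AlgebraicClosure K) (toClosure p) hp0 ∈ zeroSet F ↔ eval p F = 0 := by
  rw [mk_mem_zeroSet_iff hF, aeval_toClosure, map_eq_zero]

theorem mem_affineCone_zeroSet_iff {F : MvPolynomial (Fin (n + 1)) K} {d : ℕ}
    (hF : F.IsHomogeneous d) (hd : d ≠ 0) {w : Fin (n + 1) → AlgebraicClosure K} :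
    w ∈ affineCone (zeroSet F : Set (GeomPoint K n)) ↔ aeval w F = 0 := by
  rcases eq_or_ne w 0 with rfl | hw
  · refine iff_of_true zero_mem_affineCone ?_
    simpa [hd] using aeval_smul_of_isHomogeneous hF (0 : AlgebraicClosure K) 0
  · rw [← mk_mem_zeroSet_iff hF hw]
    exact forall_prop_of_true hw

theorem isLinearMap_aeval {A : Type*} [CommRing A] [Algebra K A]
    {l : MvPolynomial (Fin (n + 1)) K} (hl : l.IsHomogeneous 1) :
    IsLinearMap A fun v : Fin (n + 1) → A => aeval v l where
  map_add u v := by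
    have h : l ∈ homogeneousSubmodule (Fin (n + 1)) K 1 := hl
    rw [homogeneousSubmodule_one_eq_span_X] at h
    clear hl
    induction h using Submodule.span_induction with
    | mem x hx => obtain ⟨i, rfl⟩ := hx; simp
    | zero => simp
    | add x y _ _ hx hy => simp only [map_add, hx, hy]; ring
    | smul c x _ hx => simp only [map_smul, hx, smul_add]
  map_smul c v := by simp [aeval_smul_of_isHomogeneous hl]

theorem aeval_add_smul_of_isHomogeneous_one {A : Type*} [CommRing A] [Algebra K A]
    {l : MvPolynomial (Fin (n + 1)) K} (hl : l.IsHomogeneous 1) (u v : Fin (n + 1) → A) (c : A) :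
    aeval (u + c • v) l = aeval u l + c * aeval v l :=
  ((isLinearMap_aeval hl).map_add u (c • v)).trans
    (congrArg _ ((isLinearMap_aeval hl).map_smul c v))

theorem affineCone_cone {p : Fin (n + 1) → AlgebraicClosure K} (hp : p ≠ 0)
    {C : Set (GeomPoint K n)} (hC : C.Nonempty) :
    affineCone (cone (Projectivization.mk (AlgebraicClosure K) p hp) C) =
      {w | ∃ y ∈ affineCone C, ∃ t : AlgebraicClosure K, y + t • p = w} := by
  ext w
  constructor
  · intro hw
    rcases eq_or_ne w 0 with rfl | hw0
    · exact ⟨0, zero_mem_affineCone, 0, by simp⟩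
    obtain ⟨z, hz, hle⟩ := hw hw0
    rw [Projectivization.submodule_mk, Projectivization.submodule_mk,
      Projectivization.submodule_eq, Submodule.span_singleton_le_iff_mem,
      ← Submodule.span_union, Set.singleton_union, Submodule.mem_span_pair] at hle
    obtain ⟨a, b, rfl⟩ := hle
    exact ⟨b • z.rep, smul_mem_affineCone (rep_mem_affineCone_iff.2 hz) b, a, add_comm _ _⟩
  · rintro ⟨y, hy, t, rfl⟩ hw
    obtain ⟨z, hz, hyz⟩ : ∃ z ∈ C, y ∈ z.submodule := by
      rcases eq_or_ne y 0 with rfl | hy0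
      · exact ⟨hC.some, hC.some_mem, zero_mem _⟩
      · exact ⟨_, hy hy0, Submodule.mem_span_singleton_self (R := AlgebraicClosure K) y⟩
    refine ⟨z, hz, (Submodule.span_singleton_le_iff_mem _ _).2 (add_mem ?_ ?_)⟩
    · exact Submodule.mem_sup_right hyz
    · exact Submodule.mem_sup_left (Submodule.smul_mem _ t (Submodule.mem_span_singleton_self p))

theorem add_smul_mem_affineCone_cone_iff {p : Fin (n + 1) → AlgebraicClosure K} (hp : p ≠ 0)
    {l : MvPolynomial (Fin (n + 1)) K} (hl : l.IsHomogeneous 1) (hlp : aeval p l ≠ 0)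
    {C : Set (GeomPoint K n)} (hC : C.Nonempty) (hCl : C ⊆ zeroSet l)
    {y : Fin (n + 1) → AlgebraicClosure K} (hy : aeval y l = 0) (t : AlgebraicClosure K) :
    y + t • p ∈ affineCone (cone (Projectivization.mk (AlgebraicClosure K) p hp) C) ↔
      y ∈ affineCone C := by
  rw [affineCone_cone hp hC]
  refine ⟨?_, fun h => ⟨y, h, t, rfl⟩⟩
  rintro ⟨z, hz, s, hzy⟩
  have hz0 : aeval z l = 0 :=
    (mem_affineCone_zeroSet_iff hl one_ne_zero).1 fun hz0 => hCl (hz hz0)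
  have hst : s = t := by
    have h := congrArg (fun v => aeval v l) hzy
    simpa [aeval_add_smul_of_isHomogeneous_one hl, hz0, hy, hlp] using h
  rw [hst] at hzy
  rwa [← add_right_cancel hzy]

section HermitianCount

variable [StarRing K] {q : ℕ}

theorem toClosure_preimage_affineCone_hermitianVariety (hstar : ∀ x : K, star x = x ^ q)
    (H : Matrix (Fin (n + 1)) (Fin (n + 1)) K) :
    toClosure ⁻¹' affineCone (hermitianVariety q H) = isotropicVectors H := by
  ext v
  rw [Set.mem_preimage, hermitianVariety,
    mem_affineCone_zeroSet_iff (hermitianPoly_isHomogeneous q H) q.succ_ne_zero, aeval_toClosure,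
    map_eq_zero, eval_hermitianPoly hstar, mem_isotropicVectors]

theorem ncard_rationalPoints_hermitianVariety_inter_cone [Fintype K]
    (hK : Fintype.card K = q ^ 2) (hstar : ∀ x : K, star x = x ^ q)
    {H : Matrix (Fin (n + 1)) (Fin (n + 1)) K} (hH : H.IsHermitian)
    {p : Fin (n + 1) → K} (hpH : p ᵥ* H = 0) (hp : toClosure p ≠ 0)
    {l : MvPolynomial (Fin (n + 1)) K} (hl : l.IsHomogeneous 1) (hlp : eval p l ≠ 0)
    {C : Set (GeomPoint K n)} (hC : C.Nonempty) (hCl : C ⊆ zeroSet l) :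
    (rationalPoints (hermitianVariety q H ∩
      cone (Projectivization.mk (AlgebraicClosure K) _ hp) C)).ncard =
      1 + q ^ 2 * (rationalPoints (C ∩ hermitianVariety q H)).ncard := by
  have hlp' : aeval (toClosure p) l ≠ 0 := by rwa [aeval_toClosure, map_ne_zero]
  have hmul := ncard_eq_card_mul_ncard_of_add_smul_mem_iff
    (l := (isLinearMap_aeval hl).mk' fun v : Fin (n + 1) → K => aeval v l) (p := p) (k := K) hlp
    (S := toClosure ⁻¹' affineCone (hermitianVariety q H ∩
      cone (Projectivization.mk (AlgebraicClosure K) _ hp) C))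
    (T := toClosure ⁻¹' affineCone (C ∩ hermitianVariety q H)) ?_ ?_
  · rw [ncard_toClosure_preimage_affineCone, ncard_toClosure_preimage_affineCone,
      Nat.card_eq_fintype_card, hK] at hmul
    have hq : 2 ≤ q := two_le_of_card_eq_sq hK
    have hq2 : 4 ≤ q ^ 2 := by nlinarith
    zify [show 1 ≤ q ^ 2 by omega] at hmul ⊢
    refine mul_left_cancel₀ (show (q : ℤ) ^ 2 - 1 ≠ 0 by zify at hq2; linarith) ?_
    linear_combination hmul
  · intro y hy
    rw [Set.mem_preimage, affineCone_inter] at hy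
    have hyl : aeval (toClosure y) l = 0 :=
      (mem_affineCone_zeroSet_iff hl one_ne_zero).1 fun hy0 => hCl (hy.1 hy0)
    rwa [aeval_toClosure, map_eq_zero] at hyl
  · intro y t (hy : eval y l = 0)
    have hy' : aeval (toClosure y) l = 0 := by rw [aeval_toClosure, hy, map_zero]
    rw [affineCone_inter, affineCone_inter, Set.preimage_inter, Set.preimage_inter,
      toClosure_preimage_affineCone_hermitianVariety hstar, Set.inter_comm, Set.mem_inter_iff,
      Set.mem_inter_iff, add_smul_mem_isotropicVectors_iff hH hpH, Set.mem_preimage, map_add,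
      map_smulₛₗ, add_smul_mem_affineCone_cone_iff hp hl hlp' hC hCl hy', Set.mem_preimage]

theorem ncard_rationalPoints_hermitianVariety_inter_cone_eq_iff [Fintype K]
    (hK : Fintype.card K = q ^ 2) (hstar : ∀ x : K, star x = x ^ q)
    {H : Matrix (Fin (n + 1)) (Fin (n + 1)) K} (hH : H.IsHermitian)
    {p : Fin (n + 1) → K} (hpH : p ᵥ* H = 0) (hp : toClosure p ≠ 0)
    {E C : Set (GeomPoint K n)} (hE : IsHyperplane E)
    (hpE : Projectivization.mk (AlgebraicClosure K) _ hp ∉ E) (hCE : C ⊆ E)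
    {N : ℕ} (hN : N ≠ 0) :
    (rationalPoints (hermitianVariety q H ∩
      cone (Projectivization.mk (AlgebraicClosure K) _ hp) C)).ncard = 1 + q ^ 2 * N ↔
      (rationalPoints (C ∩ hermitianVariety q H)).ncard = N := by
  obtain ⟨l, hl, -, rfl⟩ := hE
  rw [mk_toClosure_mem_zeroSet_iff hl] at hpE
  rcases C.eq_empty_or_nonempty with rfl | hC
  · simp [rationalPoints, cone, hN.symm, add_comm 1]
  · have hq : q ^ 2 ≠ 0 := hK ▸ Fintype.card_ne_zero
    rw [ncard_rationalPoints_hermitianVariety_inter_cone hK hstar hH hpH hp hl hpE hC hCE,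
      add_right_inj, mul_right_inj' hq]

end HermitianCount

end Geometric

section LineExpansion

variable {K : Type*} [Field K] {n : ℕ}

/-- The expansion of `F (y + t p)` in powers of `t`, with coefficients polynomials in the
coordinates `y` of the hyperplane `x_i = 0`. -/
noncomputable def lineExpansion (p : Fin (n + 1) → K) (i : Fin (n + 1)) :
    MvPolynomial (Fin (n + 1)) K →ₐ[K] Polynomial (MvPolynomial (Fin n) K) :=
  (finSuccEquiv K n).toAlgHom.comp (aeval (hyperplaneEmb (R := MvPolynomial (Fin (n + 1)) K) i
    (fun j => X j.succ) + (X 0 : MvPolynomial (Fin (n + 1)) K) • fun k => C (p k)))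

theorem eval_lineExpansion {A : Type*} [CommRing A] [Algebra K A] (p : Fin (n + 1) → K)
    (i : Fin (n + 1)) (F : MvPolynomial (Fin (n + 1)) K) (y : Fin n → A) (t : A) :
    ((lineExpansion p i F).map (aeval y).toRingHom).eval t =
      aeval (hyperplaneEmb i y + t • fun k => algebraMap K A (p k)) F := by
  rw [Polynomial.eval_map]
  have h : (Polynomial.eval₂RingHom (aeval y).toRingHom t).comp (lineExpansion p i).toRingHom =
      (aeval (hyperplaneEmb i y + t • fun k => algebraMap K A (p k))).toRingHom := by
    apply MvPolynomial.ringHom_ext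
    · intro c
      simp [lineExpansion, finSuccEquiv_apply]
    · intro k
      induction k using i.succAboveCases <;> simp [lineExpansion, finSuccEquiv_apply, mul_comm t]
  exact congrArg (fun f => f F) h

section

variable (p : Fin (n + 1) → K) (i : Fin (n + 1)) {F : MvPolynomial (Fin (n + 1)) K} {d : ℕ}

theorem isHomogeneous_finSuccEquiv_symm_lineExpansion (hF : F.IsHomogeneous d) :
    ((finSuccEquiv K n).symm (lineExpansion p i F)).IsHomogeneous d := by
  rw [lineExpansion, AlgHom.comp_apply]
  refine one_mul d ▸ ((finSuccEquiv K n).symm_apply_apply _).symm ▸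
    hF.aeval (n := 1) _ fun k => ?_
  have hp : (X 0 * C (p k) : MvPolynomial (Fin (n + 1)) K).IsHomogeneous 1 :=
    (isHomogeneous_X _ _).mul (isHomogeneous_C _ _)
  induction k using i.succAboveCases
  · simpa using hp
  · simpa using (isHomogeneous_X _ _).add hp

theorem isHomogeneous_coeff_lineExpansion (hF : F.IsHomogeneous d) {k : ℕ} (hk : k ≤ d) :
    ((lineExpansion p i F).coeff k).IsHomogeneous (d - k) := by
  have hhom := isHomogeneous_finSuccEquiv_symm_lineExpansion p i hF
  simpa using hhom.finSuccEquiv_coeff_isHomogeneous k (d - k) (by omega)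

theorem natDegree_lineExpansion_le (hF : F.IsHomogeneous d) :
    (lineExpansion p i F).natDegree ≤ d := by
  have hhom := isHomogeneous_finSuccEquiv_symm_lineExpansion p i hF
  rw [← (finSuccEquiv K n).apply_symm_apply (lineExpansion p i F), natDegree_finSuccEquiv]
  exact (degreeOf_le_totalDegree _ _).trans hhom.totalDegree_le

end

theorem ncard_setOf_eval_hyperplaneEmb_add_smul_le (p : Fin (n + 1) → K) (i : Fin (n + 1))
    (F : MvPolynomial (Fin (n + 1)) K) {y : Fin n → K}
    (hy : eval y (lineExpansion p i F).leadingCoeff ≠ 0) :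
    {t : K | eval (hyperplaneEmb i y + t • p) F = 0}.ncard ≤ (lineExpansion p i F).natDegree := by
  have hne : (lineExpansion p i F).map (aeval (R := K) y).toRingHom ≠ 0 := fun h0 => by
    have := congrArg (·.coeff (lineExpansion p i F).natDegree) h0
    rw [Polynomial.coeff_map, Polynomial.coeff_zero] at this
    exact hy this
  have h := (ncard_setOf_eval_eq_zero_le hne).trans Polynomial.natDegree_map_le
  simp_rw [eval_lineExpansion] at h
  exact h

end LineExpansion

section VertexLines

variable {K : Type*} [Field K] {n : ℕ} {H : Matrix (Fin (n + 1)) (Fin (n + 1)) K}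
  {p : Fin (n + 1) → K} {i : Fin (n + 1)}

theorem hyperplaneEmb_vecMul_apply_succAbove {R : Type*} [CommRing R]
    (H : Matrix (Fin (n + 1)) (Fin (n + 1)) R) (i : Fin (n + 1)) (y : Fin n → R) (j : Fin n) :
    (hyperplaneEmb i y ᵥ* H) (i.succAbove j) =
      (y ᵥ* H.submatrix i.succAbove i.succAbove) j := by
  simp [vecMul, dotProduct, Fin.sum_univ_succAbove _ i]

variable [StarRing K]

theorem hyperplaneEmb_mem_isotropicVectors_iff (y : Fin n → K) :
    hyperplaneEmb i y ∈ isotropicVectors H ↔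
      y ∈ isotropicVectors (H.submatrix i.succAbove i.succAbove) := by
  rw [mem_isotropicVectors, mem_isotropicVectors, dotProduct_mulVec, dotProduct_mulVec,
    dotProduct, dotProduct, Fin.sum_univ_succAbove _ i]
  simp [hyperplaneEmb_vecMul_apply_succAbove]

theorem isUnit_det_submatrix_succAbove (hH : H.IsHermitian) (hpH : p ᵥ* H = 0) (hp : p i = 1)
    (hker : ∀ v, v ᵥ* H = 0 → ∃ c : K, c • p = v) :
    IsUnit (H.submatrix i.succAbove i.succAbove).det := by
  rw [isUnit_iff_ne_zero]
  intro hdet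
  obtain ⟨y, hy0, hy⟩ := exists_vecMul_eq_zero_iff.2 hdet
  have hsucc : ∀ j, (hyperplaneEmb i y ᵥ* H) (i.succAbove j) = 0 := fun j => by
    rw [hyperplaneEmb_vecMul_apply_succAbove, hy, Pi.zero_apply]
  have hself : (hyperplaneEmb i y ᵥ* H) i = 0 := by
    have h := dotProduct_mulVec (hyperplaneEmb i y) H (star p)
    rw [mulVec_star_eq_zero hH hpH, dotProduct_zero, dotProduct, Fin.sum_univ_succAbove _ i] at h
    simpa [hsucc, hp] using h.symm
  obtain ⟨c, hc⟩ := hker _ (funext ((Fin.forall_iff_succAbove i).2 ⟨hself, hsucc⟩))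
  have hc0 : c = 0 := by simpa [hp] using congrFun hc i
  rw [hc0, zero_smul, eq_comm, map_eq_zero_iff _ (hyperplaneEmb_injective i)] at hc
  exact hy0 hc

end VertexLines

section PointCount

theorem sum_le_mul_ncard_add_mul_ncard_diff {ι : Type*} [Fintype ι] {g : ι → ℕ} {A U : Set ι}
    {N m : ℕ} (hA : ∀ y ∈ A, g y ≤ N) (hU : ∀ y ∈ U \ A, g y ≤ m) (hU' : ∀ y ∉ U, g y = 0) :
    ∑ y, g y ≤ N * A.ncard + m * (U \ A).ncard := by
  classical
  calc ∑ y, g y ≤ ∑ y, ((if y ∈ A then N else 0) + if y ∈ U \ A then m else 0) := by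
        gcongr with y
        by_cases hyA : y ∈ A
        · simpa [hyA] using hA y hyA
        · by_cases hyU : y ∈ U
          · simpa [hyA, hyU] using hU y ⟨hyU, hyA⟩
          · simp [hU' y hyU]
    _ = N * A.ncard + m * (U \ A).ncard := by
        rw [Finset.sum_add_distrib, ← Finset.sum_filter, ← Finset.sum_filter, Finset.sum_const,
          Finset.sum_const, Set.ncard_eq_toFinset_card', Set.ncard_eq_toFinset_card',
          Set.filter_mem_univ_eq_toFinset, Set.filter_mem_univ_eq_toFinset, smul_eq_mul,
          smul_eq_mul, mul_comm N, mul_comm m]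

theorem mul_add_mul_lt_of_le {q d m a b : ℕ} (hq : 2 ≤ q) (hm : 1 ≤ m) (hmd : m ≤ d)
    (hdq : d ≤ q) (ha : a ≤ 1 + (q ^ 2 - 1) * ((q + 1) * (d - m)))
    (hab : a + b ≤ 1 + (q ^ 2 - 1) * (q ^ 3 + q + 1)) :
    q ^ 2 * a + m * b < 1 + (q ^ 2 - 1) * (1 + q ^ 2 * (d * (q + 1))) := by
  have hq2 : 1 ≤ q ^ 2 := Nat.one_le_pow _ _ (by omega)
  have : (m : ℤ) ≤ d := by exact_mod_cast hmd
  zify [hq2, hmd] at hq hm hdq ha hab ⊢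
  set Q : ℤ := (q : ℤ) ^ 2 - 1 with hQ
  have hQ0 : 0 < Q := by nlinarith
  have hsplit : (q : ℤ) ^ 2 * a + m * b = (q ^ 2 - m) * a + m * (a + b) := by ring
  have ha' : ((q : ℤ) ^ 2 - m) * a ≤ (q ^ 2 - m) * (1 + Q * ((q + 1) * (d - m))) :=
    mul_le_mul_of_nonneg_left ha (by nlinarith)
  have hab' : (m : ℤ) * (a + b) ≤ m * (1 + Q * (q ^ 3 + q + 1)) :=
    mul_le_mul_of_nonneg_left hab (by omega)
  have hgap : 0 < Q * (m * ((q : ℤ) ^ 2 - q - 1 + (d - m) * (q + 1))) := by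
    have : 0 ≤ ((d : ℤ) - m) * (q + 1) := mul_nonneg (by omega) (by omega)
    exact mul_pos hQ0 (mul_pos (by omega) (by nlinarith))
  rw [hsplit]
  refine lt_of_le_of_lt (add_le_add ha' hab') ?_
  linear_combination hgap + hQ

variable {K : Type*} [Field K] [Fintype K] [StarRing K] {q : ℕ}

theorem ncard_isotropicVectors_inter_le (hK : Fintype.card K = q ^ 2)
    (hstar : ∀ x : K, star x = x ^ q) {M : Matrix (Fin 3) (Fin 3) K} (hM : IsUnit M.det)
    {G : MvPolynomial (Fin 3) K} {e : ℕ} (hG : G.IsHomogeneous e) (hG0 : G ≠ 0) (he : e ≤ q) :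
    (isotropicVectors M ∩ {y | eval y G = 0}).ncard ≤ 1 + (q ^ 2 - 1) * ((q + 1) * e) := by
  classical
  let h := hermitianPoly (n := 2) q M
  have hhom : h.IsHomogeneous (q + 1) := hermitianPoly_isHomogeneous q M
  have hqK : (q : K) = 0 := by
    have := Nat.cast_card_eq_zero K
    rwa [hK, Nat.cast_pow, sq_eq_zero_iff] at this
  have hirr : Irreducible h := irreducible_hermitianPoly hqK le_rfl hM
  have hrel : IsRelPrime h G := hirr.isRelPrime_iff_not_dvd.2 fun hdvd => by
    have := totalDegree_le_of_dvd_of_isDomain hdvd hG0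
    rw [hhom.totalDegree hirr.ne_zero, hG.totalDegree hG0] at this
    omega
  let S : Set (ℙ K (Fin 3 → K)) := {x | eval x.rep h = 0 ∧ eval x.rep G = 0}
  have hS : S.ncard ≤ (q + 1) * e := by
    rw [Set.ncard_eq_toFinset_card S]
    exact card_le_mul_of_forall_eval_eq_zero hhom hG hirr.ne_zero hG0 hrel _ fun x hx =>
      S.toFinite.mem_toFinset.1 hx
  have hsub : isotropicVectors M ∩ {y | eval y G = 0} ⊆ affineCone S := by
    rintro y ⟨hyM, hyG : eval y G = 0⟩ hy
    rw [mem_isotropicVectors, ← eval_hermitianPoly hstar] at hyM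
    obtain ⟨a, ha⟩ := Projectivization.exists_smul_eq_mk_rep K y hy
    have hsmul : ∀ {P : MvPolynomial (Fin 3) K} {m}, P.IsHomogeneous m → eval y P = 0 →
        eval (Projectivization.mk K y hy).rep P = 0 := fun hP h0 => by
      rw [← ha, Units.smul_def, ← aeval_eq_eval, aeval_smul_of_isHomogeneous hP, aeval_eq_eval,
        h0, mul_zero]
    exact ⟨hsmul hhom hyM, hsmul hG hyG⟩
  calc _ ≤ (affineCone S).ncard := Set.ncard_le_ncard hsub
    _ ≤ 1 + (q ^ 2 - 1) * ((q + 1) * e) := by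
      rw [ncard_affineCone, Nat.card_eq_fintype_card, hK]
      gcongr

theorem ncard_isotropicVectors_inter_le_add {n : ℕ} {H : Matrix (Fin (n + 1)) (Fin (n + 1)) K}
    (hH : H.IsHermitian) {p : Fin (n + 1) → K} (hpH : p ᵥ* H = 0) {i : Fin (n + 1)} (hp : p i = 1)
    (F : MvPolynomial (Fin (n + 1)) K) {U A : Set (Fin n → K)}
    (hU : U = isotropicVectors (H.submatrix i.succAbove i.succAbove))
    (hA : A = U ∩ {y | eval y (lineExpansion p i F).leadingCoeff = 0}) :
    (isotropicVectors H ∩ {v | eval v F = 0}).ncard ≤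
      Fintype.card K * A.ncard + (lineExpansion p i F).natDegree * (U \ A).ncard := by
  subst hA
  have hfiber (y : Fin n → K) :
      {t : K | hyperplaneEmb i y + t • p ∈ isotropicVectors H ∩ {v | eval v F = 0}} =
        {t : K | y ∈ U ∧ eval (hyperplaneEmb i y + t • p) F = 0} := by
    ext t
    exact and_congr_left' ((add_smul_mem_isotropicVectors_iff hH hpH _ t).trans
      (hU ▸ hyperplaneEmb_mem_isotropicVectors_iff y))
  rw [ncard_eq_sum_ncard_line hp]
  simp_rw [hfiber]
  refine sum_le_mul_ncard_add_mul_ncard_diff (fun y _ => ?_) (fun y hy => ?_) fun y hy => ?_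
  · exact Nat.card_eq_fintype_card (α := K) ▸ Set.ncard_le_card _
  · exact (Set.ncard_le_ncard fun t ht => ht.2).trans
      (ncard_setOf_eval_hyperplaneEmb_add_smul_le p i F fun h0 => hy.2 ⟨hy.1, h0⟩)
  · simp [hy]

theorem ncard_isotropicVectors_inter_lt (hK : Fintype.card K = q ^ 2)
    (hstar : ∀ x : K, star x = x ^ q) {H : Matrix (Fin 4) (Fin 4) K} (hH : H.IsHermitian)
    {p : Fin 4 → K} (hpH : p ᵥ* H = 0) {i : Fin 4} (hp : p i = 1)
    (hker : ∀ v, v ᵥ* H = 0 → ∃ c : K, c • p = v)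
    {d : ℕ} (hdq : d ≤ q) {F : MvPolynomial (Fin 4) K} (hF : F.IsHomogeneous d)
    (hdeg : (lineExpansion (n := 3) p i F).natDegree ≠ 0) :
    (isotropicVectors H ∩ {v | eval v F = 0}).ncard <
      1 + (q ^ 2 - 1) * (1 + q ^ 2 * (d * (q + 1))) := by
  set f := lineExpansion (n := 3) p i F
  have hM : IsUnit (H.submatrix i.succAbove i.succAbove).det :=
    isUnit_det_submatrix_succAbove (n := 3) hH hpH hp hker
  have hmd : f.natDegree ≤ d := natDegree_lineExpansion_le (n := 3) p i hF
  have hlead : f.leadingCoeff.IsHomogeneous (d - f.natDegree) :=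
    isHomogeneous_coeff_lineExpansion (n := 3) p i hF hmd
  have hlead0 : f.leadingCoeff ≠ 0 := Polynomial.leadingCoeff_ne_zero.2 fun h0 =>
    hdeg (h0 ▸ Polynomial.natDegree_zero)
  refine (ncard_isotropicVectors_inter_le_add (n := 3) hH hpH hp F rfl rfl).trans_lt ?_
  rw [hK]
  refine mul_add_mul_lt_of_le (two_le_of_card_eq_sq hK) (Nat.one_le_iff_ne_zero.2 hdeg) hmd hdq
    ?_ ?_
  · exact ncard_isotropicVectors_inter_le hK hstar hM hlead hlead0 (by omega)
  · rw [add_comm, Set.ncard_sdiff_add_ncard_of_subset Set.inter_subset_left]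
    exact ncard_isotropicVectors_le hK hstar hM

end PointCount

section Vertex

variable {K : Type*} [Field K]

theorem exists_smul_eq_of_vecMul_eq_zero {m k : Type*} [Fintype m] [Fintype k] {H : Matrix m k K}
    (hrank : Fintype.card m ≤ H.rank + 1) {p v : m → K} (hp0 : p ≠ 0) (hp : p ᵥ* H = 0)
    (hv : v ᵥ* H = 0) : ∃ c : K, c • p = v := by
  by_contra! h
  have hind : LinearIndependent K (Matrix.of ![p, v]).row :=
    (LinearIndependent.pair_iff' hp0).2 h
  have hmul : Matrix.of ![p, v] * H = 0 := by
    ext a j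
    fin_cases a
    exacts [congrFun hp j, congrFun hv j]
  have hle := rank_add_rank_le_card_of_mul_eq_zero hmul
  rw [hind.rank_matrix, Fintype.card_fin] at hle
  omega

variable {n : ℕ} {H : Matrix (Fin (n + 1)) (Fin (n + 1)) K}

theorem exists_vecMul_eq_zero_and_forall_exists_smul_eq (hrank : H.rank = n) :
    ∃ (p : Fin (n + 1) → K) (i : Fin (n + 1)), p i = 1 ∧ p ᵥ* H = 0 ∧
      ∀ v, v ᵥ* H = 0 → ∃ c : K, c • p = v := by
  have hdet : H.det = 0 := by
    by_contra h
    simp [rank_of_det_ne_zero h] at hrank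
  obtain ⟨v, hv0, hv⟩ := exists_vecMul_eq_zero_iff.2 hdet
  obtain ⟨i, hi⟩ := Function.ne_iff.1 hv0
  have hp : ((v i)⁻¹ • v) ᵥ* H = 0 := by rw [smul_vecMul, hv, smul_zero]
  refine ⟨(v i)⁻¹ • v, i, inv_mul_cancel₀ hi, hp, fun w hw =>
    exists_smul_eq_of_vecMul_eq_zero (by simp [hrank]) ?_ hp hw⟩
  exact smul_ne_zero (inv_ne_zero hi) hv0

theorem eq_mk_of_mem_singularSpace {p : Fin (n + 1) → K} (hp0 : toClosure p ≠ 0)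
    (hpH : p ᵥ* H = 0) {i : Fin (n + 1)} (hdet : IsUnit (H.submatrix i.succAbove i.succAbove).det)
    {P : GeomPoint K n} (hP : P ∈ singularSpace H) :
    P = Projectivization.mk (AlgebraicClosure K) (toClosure p) hp0 := by
  let ι := algebraMap K (AlgebraicClosure K)
  have hrank : n ≤ (H.map ι).rank := by
    have hunit : IsUnit ((H.submatrix i.succAbove i.succAbove).map ι) := by
      rw [isUnit_iff_isUnit_det, ← RingHom.mapMatrix_apply, ← RingHom.map_det]
      exact hdet.map ι
    simpa [submatrix_map, rank_of_isUnit _ hunit] using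
      (H.map ι).rank_submatrix_le i.succAbove i.succAbove
  have hpH' : toClosure p ᵥ* H.map ι = 0 := by
    ext j
    refine (RingHom.map_vecMul ι H p j).symm.trans ?_
    rw [hpH, Pi.zero_apply, Pi.zero_apply, map_zero]
  rw [← P.mk_rep, Projectivization.mk_eq_mk_iff']
  exact exists_smul_eq_of_vecMul_eq_zero (by simpa using hrank) hp0 hpH' hP

end Vertex

section ConesOfForms

variable {K : Type*} [Field K] {n d : ℕ} {p : Fin (n + 1) → K} {i : Fin (n + 1)}
  {F : MvPolynomial (Fin (n + 1)) K}

theorem exists_hyperplaneEmb_add_smul_toClosure (hp : p i = 1)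
    (w : Fin (n + 1) → AlgebraicClosure K) :
    ∃ y, ∃ t : AlgebraicClosure K, hyperplaneEmb i y + t • toClosure p = w :=
  exists_hyperplaneEmb_add_smul (by rw [toClosure_apply, hp, map_one]) w

theorem aeval_add_smul_toClosure (hdeg : (lineExpansion p i F).natDegree = 0)
    (y : Fin n → AlgebraicClosure K) (t : AlgebraicClosure K) :
    aeval (hyperplaneEmb i y + t • toClosure p) F = aeval (hyperplaneEmb i y) F := by
  have h (s : AlgebraicClosure K) : aeval (hyperplaneEmb i y + s • toClosure p) F =
      aeval y ((lineExpansion p i F).coeff 0) := by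
    refine (eval_lineExpansion p i F y s).symm.trans ?_
    rw [Polynomial.eq_C_of_natDegree_eq_zero hdeg, Polynomial.map_C, Polynomial.eval_C,
      Polynomial.coeff_C_zero]
    rfl
  rw [h t, ← h 0, zero_smul, add_zero]

theorem nonempty_zeroSet_X_inter_zeroSet (hF : F.IsHomogeneous d) (hp : p i = 1)
    (hdeg : (lineExpansion p i F).natDegree = 0) (hp0 : toClosure p ≠ 0) {x : GeomPoint K n}
    (hx : x ∈ zeroSet F)
    (hxp : x ≠ Projectivization.mk (AlgebraicClosure K) (toClosure p) hp0) :
    (zeroSet (X i) ∩ zeroSet F : Set (GeomPoint K n)).Nonempty := by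
  obtain ⟨y, t, hyt⟩ := exists_hyperplaneEmb_add_smul_toClosure hp x.rep
  have hy : hyperplaneEmb i y ≠ 0 := fun hy => by
    rw [hy, zero_add] at hyt
    exact hxp (x.mk_rep ▸ (Projectivization.mk_eq_mk_iff' _ _ _ _ _).2 ⟨t, hyt⟩)
  refine ⟨Projectivization.mk (AlgebraicClosure K) _ hy, ?_, ?_⟩
  · rw [mk_mem_zeroSet_iff (isHomogeneous_X K i), aeval_X, hyperplaneEmb_apply_self]
  · rw [mk_mem_zeroSet_iff hF, ← aeval_add_smul_toClosure hdeg y t, hyt]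
    exact hx

theorem zeroSet_eq_cone (hF : F.IsHomogeneous d) (hd : d ≠ 0) (hp : p i = 1)
    (hdeg : (lineExpansion p i F).natDegree = 0) (hp0 : toClosure p ≠ 0)
    (hC : (zeroSet (X i) ∩ zeroSet F : Set (GeomPoint K n)).Nonempty) :
    zeroSet F = cone (Projectivization.mk (AlgebraicClosure K) (toClosure p) hp0)
      (zeroSet (X i) ∩ zeroSet F) := by
  ext x
  obtain ⟨y, t, hyt⟩ := exists_hyperplaneEmb_add_smul_toClosure hp x.rep
  have hX := isHomogeneous_X K i
  have hXp : aeval (toClosure p) (X i : MvPolynomial (Fin (n + 1)) K) ≠ 0 := by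
    simp [hp]
  have hXy : aeval (hyperplaneEmb i y) (X i : MvPolynomial (Fin (n + 1)) K) = 0 := by simp
  rw [← rep_mem_affineCone_iff, ← rep_mem_affineCone_iff, ← hyt,
    add_smul_mem_affineCone_cone_iff hp0 hX hXp hC Set.inter_subset_left hXy, affineCone_inter,
    Set.mem_inter_iff, mem_affineCone_zeroSet_iff hX one_ne_zero, mem_affineCone_zeroSet_iff hF hd,
    mem_affineCone_zeroSet_iff hF hd, aeval_add_smul_toClosure hdeg, and_iff_right hXy]

theorem not_zeroSet_X_subset_zeroSet (hF : F.IsHomogeneous d) (hd : d ≠ 0) (hF0 : F ≠ 0)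
    (hp : p i = 1) (hdeg : (lineExpansion p i F).natDegree = 0) :
    ¬ (zeroSet (X i) : Set (GeomPoint K n)) ⊆ zeroSet F := by
  intro hsub
  have hzero (w : Fin (n + 1) → AlgebraicClosure K) : aeval w F = 0 := by
    obtain ⟨y, t, rfl⟩ := exists_hyperplaneEmb_add_smul_toClosure hp w
    have hy : hyperplaneEmb i y ∈ affineCone (zeroSet (X i) : Set (GeomPoint K n)) :=
      (mem_affineCone_zeroSet_iff (isHomogeneous_X K i) one_ne_zero).2 (by simp)
    rw [aeval_add_smul_toClosure hdeg, ← mem_affineCone_zeroSet_iff hF hd]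
    exact fun hy0 => hsub (hy hy0)
  refine hF0 (map_injective _ (algebraMap K (AlgebraicClosure K)).injective ?_)
  rw [map_zero]
  exact MvPolynomial.funext fun w => by rw [eval_map, map_zero]; exact hzero w

theorem IsHypersurfaceIn.subset {E C : Set (GeomPoint K n)} (hC : IsHypersurfaceIn E C) :
    C ⊆ E := by
  obtain ⟨e, G, -, -, -, rfl⟩ := hC
  exact Set.inter_subset_left

theorem exists_zeroSet_eq_cone (hF : F.IsHomogeneous d) (hd : d ≠ 0) (hF0 : F ≠ 0) (hp : p i = 1)
    (hdeg : (lineExpansion p i F).natDegree = 0) (hp0 : toClosure p ≠ 0) {x : GeomPoint K n}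
    (hx : x ∈ zeroSet F)
    (hxp : x ≠ Projectivization.mk (AlgebraicClosure K) (toClosure p) hp0) :
    ∃ E C : Set (GeomPoint K n), IsHyperplane E ∧
      Projectivization.mk (AlgebraicClosure K) (toClosure p) hp0 ∉ E ∧ IsHypersurfaceIn E C ∧
      zeroSet F = cone (Projectivization.mk (AlgebraicClosure K) (toClosure p) hp0) C := by
  have hX := isHomogeneous_X K i
  refine ⟨zeroSet (X i), zeroSet (X i) ∩ zeroSet F, ⟨_, hX, X_ne_zero i, rfl⟩, ?_,
    ⟨d, F, Nat.pos_of_ne_zero hd, hF, not_zeroSet_X_subset_zeroSet hF hd hF0 hp hdeg, rfl⟩,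
    zeroSet_eq_cone hF hd hp hdeg hp0
      (nonempty_zeroSet_X_inter_zeroSet hF hp hdeg hp0 hx hxp)⟩
  rw [mk_toClosure_mem_zeroSet_iff hX, eval_X, hp]
  exact one_ne_zero

theorem ncard_rationalPoints_hermitianVariety_inter_zeroSet_lt {K : Type*} [Field K] [Fintype K]
    [StarRing K] {q : ℕ} (hK : Fintype.card K = q ^ 2) (hstar : ∀ x : K, star x = x ^ q)
    {H : Matrix (Fin 4) (Fin 4) K} (hH : H.IsHermitian) {p : Fin 4 → K} (hpH : p ᵥ* H = 0)
    {i : Fin 4} (hp : p i = 1) (hker : ∀ v, v ᵥ* H = 0 → ∃ c : K, c • p = v)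
    {F : MvPolynomial (Fin 4) K} (hF : F.IsHomogeneous d) (hd : d ≠ 0) (hdq : d ≤ q)
    (hdeg : (lineExpansion (n := 3) p i F).natDegree ≠ 0) :
    (rationalPoints (hermitianVariety (n := 3) q H ∩ zeroSet (n := 3) F)).ncard <
      1 + q ^ 2 * (d * (q + 1)) := by
  have hzeros : toClosure (n := 3) ⁻¹' affineCone (zeroSet (n := 3) F) = {v | eval v F = 0} := by
    ext v
    rw [Set.mem_preimage, mem_affineCone_zeroSet_iff (n := 3) hF hd, aeval_toClosure, map_eq_zero,
      Set.mem_ofPred_eq]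
  have hlt := ncard_isotropicVectors_inter_lt hK hstar hH hpH hp hker hdq hF hdeg
  rw [← hzeros, ← toClosure_preimage_affineCone_hermitianVariety (n := 3) hstar,
    ← Set.preimage_inter, ← affineCone_inter, ncard_toClosure_preimage_affineCone,
    Nat.card_eq_fintype_card, hK] at hlt
  exact Nat.lt_of_mul_lt_mul_left (Nat.lt_of_add_lt_add_left hlt)

end ConesOfForms

end HermitianCone

theorem mainTheorem5 {K : Type*} [Field K] [Fintype K] (q : ℕ) (hK : Fintype.card K = q ^ 2)
    (H : Matrix (Fin 4) (Fin 4) K) (hH : HermitianCone.IsHermitianMatrix (n := 3) q H)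
    (hrank : H.rank = 3)
    (P : HermitianCone.GeomPoint K 3) (hP : P ∈ HermitianCone.singularSpace (n := 3) H)
    (d : ℕ) (hd : 1 ≤ d) (hdq : d ≤ q)
    (F : MvPolynomial (Fin 4) K) (hF : F.IsHomogeneous d) (hF0 : F ≠ 0) :
    (HermitianCone.rationalPoints
        (HermitianCone.hermitianVariety (n := 3) q H ∩ HermitianCone.zeroSet (n := 3) F)).ncard
      = 1 + q ^ 2 * d * (q + 1) ↔
    ∃ E C : Set (HermitianCone.GeomPoint K 3),
      HermitianCone.IsHyperplane E ∧ P ∉ E ∧ HermitianCone.IsHypersurfaceIn E C ∧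
      HermitianCone.zeroSet (n := 3) F = HermitianCone.cone P C ∧
      (HermitianCone.rationalPoints
        (C ∩ HermitianCone.hermitianVariety (n := 3) q H)).ncard = d * (q + 1) := by
  open HermitianCone in
  let _ : StarRing K := frobeniusStarRing hK
  have hstar (x : K) : star x = x ^ q := rfl
  have hHerm : H.IsHermitian := Matrix.ext fun i j => (hH.2 i j).symm
  obtain ⟨p, i, hp, hpH, hker⟩ := exists_vecMul_eq_zero_and_forall_exists_smul_eq (n := 3) hrank
  have hp0 : toClosure (n := 3) p ≠ 0 := fun h => by simpa [hp] using congrFun h i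
  obtain rfl := eq_mk_of_mem_singularSpace (n := 3) hp0 hpH
    (isUnit_det_submatrix_succAbove (n := 3) hHerm hpH hp hker) hP
  have hd0 : d ≠ 0 := by omega
  have hN : d * (q + 1) ≠ 0 := mul_ne_zero hd0 q.succ_ne_zero
  have hpos : 0 < q ^ 2 * (d * (q + 1)) :=
    Nat.mul_pos (hK ▸ Fintype.card_pos) (Nat.pos_of_ne_zero hN)
  rw [mul_assoc]
  constructor
  · intro hcount
    have hdeg : (lineExpansion (n := 3) p i F).natDegree = 0 := by_contra fun hdeg =>
      (ncard_rationalPoints_hermitianVariety_inter_zeroSet_lt hK hstar hHerm hpH hp hker hF hd0 hdq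
        hdeg).ne hcount
    obtain ⟨x, hx, hxp⟩ := Set.exists_ne_of_one_lt_ncard
      ((Nat.lt_add_of_pos_right hpos).trans_eq hcount.symm) _
    obtain ⟨E, C, hE, hPE, hC, hcone⟩ :=
      exists_zeroSet_eq_cone (n := 3) hF hd0 hF0 hp hdeg hp0 hx.1.2 hxp
    refine ⟨E, C, hE, hPE, hC, hcone, ?_⟩
    rwa [hcone, ncard_rationalPoints_hermitianVariety_inter_cone_eq_iff (n := 3) hK hstar hHerm hpH
      hp0 hE hPE hC.subset hN] at hcount
  · rintro ⟨E, C, hE, hPE, hC, hcone, hcount⟩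
    rwa [hcone, ncard_rationalPoints_hermitianVariety_inter_cone_eq_iff (n := 3) hK hstar hHerm hpH
      hp0 hE hPE hC.subset hN]
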